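/- Let $d\ge 1$ be an integer, $0<\gamma<\infty$, and let $\Omega\subset\mathbb{R}^d$ be a bounded domain, that is, a bounded, nonempty, open set (not necessarily connected). Assume that $\Omega$ satisfies an interior cone condition: there are $r>0$ and $\theta\in(0,\pi/2)$ such that for every $x\in\Omega$ there is a vector $\xi\in\mathbb{R}^d$ with $\|\xi\|_2=1$ such that the closed cone $$\{x+\lambda y:\ y\in\mathbb{R}^d,\ \|y\|_2=1,\ \langle y,\xi\rangle\ge\cos\theta,\ \lambda\in[0,r]\}$$ is contained in $\Omega$. Let $X_1,X_2,\ldots$ be independent random vectors, defined on a common probability space and uniformly distributed on $\Omega$, and consider the random point sets $P_n=\{X_1,\ldots,X_n\}$. Write $\operatorname{dist}(x,P_n)=\min_{y\in P_n}\|x-y\|_2$, $\operatorname{vol}$ for the $d$-dimensional Lebesgue measure, and $B(0,1)$ for the Euclidean unit ball. Then, as $n\to\infty$, $$n^{\gamma/d}\,\frac{1}{\operatorname{vol}(\Omega)}\int_{\Omega}\operatorname{dist}(x,P_n)^{\gamma}\,\mathrm{d}x\ \longrightarrow\ \left(\frac{\operatorname{vol}(\Omega)}{\operatorname{vol}(B(0,1))}\right)^{\gamma/d}\Gamma\Bigl(1+\frac{\gamma}{d}\Bigr)$$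 almost surely and in $L_p$ for every $0<p<\infty$, i.e. these random variables have finite $p$-th absolute moments, and the expectation of the $p$-th power of the absolute difference of the two sides tends to $0$. -/

import Mathlib

open MeasureTheory ProbabilityTheory Filter Topology

noncomputable section

/-- The closed cone in `ℝ^d` with apex `x`, direction `ξ`, height `r` and opening angle `θ`. -/
def closedCone {d : ℕ} (x ξ : EuclideanSpace ℝ (Fin d)) (r θ : ℝ) :
    Set (EuclideanSpace ℝ (Fin d)) :=
  {z | ∃ y : EuclideanSpace ℝ (Fin d), ∃ t : ℝ,
    ‖y‖ = 1 ∧ Real.cos θ ≤ inner ℝ y ξ ∧ 0 ≤ t ∧ t ≤ r ∧ z = x + t • y}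

/-- The interior cone condition: a common height `r > 0` and a common angle `θ ∈ (0, π/2)` such
that each point of `Ω` is the apex of a closed cone, with these parameters, contained in `Ω`. -/
def InteriorConeCondition {d : ℕ} (Ω : Set (EuclideanSpace ℝ (Fin d))) : Prop :=
  ∃ r θ : ℝ, 0 < r ∧ 0 < θ ∧ θ < Real.pi / 2 ∧
    ∀ x ∈ Ω, ∃ ξ : EuclideanSpace ℝ (Fin d), ‖ξ‖ = 1 ∧ closedCone x ξ r θ ⊆ Ω

/-- The random point set consisting of the first `n` points `X 0, …, X (n - 1)` of a sequence,
at the outcome `ω`. -/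
def randomPoints {S : Type*} {d : ℕ} (X : ℕ → S → EuclideanSpace ℝ (Fin d)) (n : ℕ) (ω : S) :
    Set (EuclideanSpace ℝ (Fin d)) :=
  {y | ∃ i < n, y = X i ω}

/-- The rescaled average `n^{γ/d} vol(Ω)⁻¹ ∫_Ω dist(x, P)^γ dx`. The distance to a finite nonempty
set `P` is `Metric.infDist x P`, since the infimum of the distances is attained. -/
def scaledDistAverage {d : ℕ} (Ω : Set (EuclideanSpace ℝ (Fin d))) (γ : ℝ) (n : ℕ)
    (P : Set (EuclideanSpace ℝ (Fin d))) : ℝ :=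
  (n : ℝ) ^ (γ / (d : ℝ)) * ((volume.real Ω)⁻¹ * ∫ x in Ω, Metric.infDist x P ^ γ)

/-- The limit constant `(vol(Ω) / vol(B(0,1)))^{γ/d} Γ(1 + γ/d)`. -/
def distLimitConstant {d : ℕ} (Ω : Set (EuclideanSpace ℝ (Fin d))) (γ : ℝ) : ℝ :=
  (volume.real Ω / volume.real (Metric.ball (0 : EuclideanSpace ℝ (Fin d)) 1)) ^ (γ / (d : ℝ)) *
    Real.Gamma (1 + γ / (d : ℝ))

end

/-! Let `m` be the uniform law on `Ω` and `ν` the measure on `(0, ∞)` with `ν (0, r) = r ^ γ`. By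
the layer-cake formula the scaled average is the `m × ν`-measure of the random set of pairs `(x, t)`
for which the ball around `x` of radius `t n ^ (-1 / d)` contains no sample point. Tonelli turns its
first two moments into integrals of the probabilities that one ball, or two balls at once, are
missed.

One ball is missed with probability tending to `exp (-κ t ^ d)`, `κ = vol B / vol Ω`
(`tendsto_cond_compl_closedBall_pow`). The cone condition dominates this by `exp (-c t ^ d)`
(`InteriorConeCondition.exists_cond_compl_closedBall_le`), so the means converge to a Gamma
integral.

Disjoint balls are negatively correlated, and meeting ones have centres at distance `O(n ^ (-1 /
d))`, so the variance is `O(1 / n)` (`exists_lintegral_section_sq_le`). This is summable along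
squares; since adding points only shortens distances, almost sure convergence passes from the
squares to all `n` (`tendsto_of_tendsto_sq`). By Jensen, `q`-th moments are controlled by first
moments with `γ * q` in place of `γ`; these uniform bounds upgrade mean-square convergence to every
`L^p`. -/

/-! ### Geometry of the cone condition and ball probabilities -/

theorem closedBall_subset_closedCone {d : ℕ} {x ξ : EuclideanSpace ℝ (Fin d)} {r θ s : ℝ}
    (hξ : ‖ξ‖ = 1) (hθ : 0 ≤ Real.cos θ) (hθ' : Real.cos θ < 1) (hs : 0 < s) (hsr : s ≤ r) :
    Metric.closedBall (x + (s / 2) • ξ) (s * ((1 - Real.cos θ) / 4)) ⊆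
      closedCone x ξ r θ ∩ Metric.closedBall x s := by
  intro z hz
  rw [Metric.mem_closedBall, dist_eq_norm] at hz
  -- After rescaling by `s`, the point lies within `ρ = (1 - cos θ) / 4` of `ξ / 2`. The angle
  -- condition then reduces to `cos θ * (1 / 2 + ρ) ≤ 1 / 2 - ρ`, that is `ρ * (1 + cos θ) ≤ 2 * ρ`.
  set v : EuclideanSpace ℝ (Fin d) := s⁻¹ • (z - x) with hv
  have hw : ‖v - (1 / 2 : ℝ) • ξ‖ ≤ (1 - Real.cos θ) / 4 := by
    have h1 : v - (1 / 2 : ℝ) • ξ = s⁻¹ • (z - (x + (s / 2) • ξ)) := by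
      have : s⁻¹ * (s / 2) = 1 / 2 := by field_simp
      rw [hv, ← sub_sub, smul_sub s⁻¹ (z - x), smul_smul, this]
    rw [h1, norm_smul, Real.norm_of_nonneg (inv_nonneg.2 hs.le), inv_mul_le_iff₀ hs]
    exact hz
  have hv_eq : v = (1 / 2 : ℝ) • ξ + (v - (1 / 2 : ℝ) • ξ) := by abel
  have hvn : ‖v‖ ≤ 1 / 2 + (1 - Real.cos θ) / 4 := by
    calc ‖v‖ = ‖(1 / 2 : ℝ) • ξ + (v - (1 / 2 : ℝ) • ξ)‖ := by rw [← hv_eq]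
      _ ≤ ‖(1 / 2 : ℝ) • ξ‖ + ‖v - (1 / 2 : ℝ) • ξ‖ := norm_add_le _ _
      _ ≤ _ := by
        rw [norm_smul, hξ]
        norm_num
        simpa using hw
  have hvi : 1 / 2 - (1 - Real.cos θ) / 4 ≤ inner ℝ v ξ := by
    have h2 : inner ℝ v ξ = 1 / 2 + inner ℝ (v - (1 / 2 : ℝ) • ξ) ξ := by
      rw [inner_sub_left, real_inner_smul_left ξ ξ, real_inner_self_eq_norm_sq, hξ]
      ring
    have h3 := abs_real_inner_le_norm (v - (1 / 2 : ℝ) • ξ) ξ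
    rw [hξ, mul_one] at h3
    have := (abs_le.1 (h3.trans hw)).1
    linarith
  have hv0 : 0 < ‖v‖ := by
    rw [norm_pos_iff]
    intro h0
    rw [h0, inner_zero_left] at hvi
    linarith
  have hvx : s • v = z - x := by rw [hv, smul_smul, mul_inv_cancel₀ hs.ne', one_smul]
  constructor
  · refine ⟨‖v‖⁻¹ • v, s * ‖v‖, ?_, ?_, by positivity, ?_, ?_⟩
    · rw [norm_smul, norm_inv, norm_norm, inv_mul_cancel₀ hv0.ne']
    · rw [real_inner_smul_left, le_inv_mul_iff₀ hv0]
      have := mul_le_mul_of_nonneg_right hvn hθ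
      nlinarith
    · refine le_trans ?_ hsr
      have : ‖v‖ ≤ 1 := by linarith
      nlinarith
    · rw [smul_smul, mul_assoc, mul_inv_cancel₀ hv0.ne', mul_one, hvx]
      abel
  · rw [Metric.mem_closedBall, dist_eq_norm, ← hvx, norm_smul, Real.norm_of_nonneg hs.le]
    have : ‖v‖ ≤ 1 := by linarith
    nlinarith

theorem volume_closedBall_eq {d : ℕ} (x : EuclideanSpace ℝ (Fin d)) {s : ℝ} (hs : 0 ≤ s) :
    volume (Metric.closedBall x s) =
      ENNReal.ofReal (s ^ d * volume.real (Metric.ball (0 : EuclideanSpace ℝ (Fin d)) 1)) := by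
  rw [Measure.addHaar_closedBall _ _ hs, ENNReal.ofReal_mul (by positivity),
    finrank_euclideanSpace_fin, measureReal_def, ENNReal.ofReal_toReal measure_ball_lt_top.ne]

theorem volume_real_unitBall_pos (d : ℕ) :
    0 < volume.real (Metric.ball (0 : EuclideanSpace ℝ (Fin d)) 1) :=
  ENNReal.toReal_pos (Metric.measure_ball_pos _ _ one_pos).ne' measure_ball_lt_top.ne

/-- Under the interior cone condition a bounded set occupies a fixed proportion of each ball
centred in it, as long as the radius does not exceed the diameter. -/
theorem InteriorConeCondition.exists_volume_inter_closedBall_ge {d : ℕ} (hd : d ≠ 0)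
    {Ω : Set (EuclideanSpace ℝ (Fin d))} (hΩ_cone : InteriorConeCondition Ω)
    (hΩ_bdd : Bornology.IsBounded Ω) :
    ∃ c R : ℝ, 0 < c ∧ (∀ x ∈ Ω, Ω ⊆ Metric.closedBall x R) ∧
      ∀ x ∈ Ω, ∀ s, 0 ≤ s → s ≤ R →
        ENNReal.ofReal (c * s ^ d) ≤ volume (Ω ∩ Metric.closedBall x s) := by
  obtain ⟨r, θ, hr, hθ, hθ', hcone⟩ := hΩ_cone
  have hcos : 0 ≤ Real.cos θ := Real.cos_nonneg_of_mem_Icc ⟨by linarith, hθ'.le⟩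
  have hcos' : Real.cos θ < 1 := by
    rw [← Real.cos_zero]
    exact Real.cos_lt_cos_of_nonneg_of_le_pi_div_two le_rfl hθ'.le hθ
  set ρ := (1 - Real.cos θ) / 4 with hρ
  have hρ0 : 0 < ρ := by rw [hρ]; linarith
  set b := volume.real (Metric.ball (0 : EuclideanSpace ℝ (Fin d)) 1) with hb
  have hb0 : 0 < b := volume_real_unitBall_pos d
  set R := max r (Metric.diam Ω) with hR
  have hR0 : 0 < R := lt_max_of_lt_left hr
  have small : ∀ x ∈ Ω, ∀ s, 0 ≤ s → s ≤ r →
      ENNReal.ofReal ((s * ρ) ^ d * b) ≤ volume (Ω ∩ Metric.closedBall x s) := by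
    intro x hx s hs hsr
    rcases hs.eq_or_lt with rfl | hs
    · simp [hd]
    obtain ⟨ξ, hξ, hsub⟩ := hcone x hx
    rw [← volume_closedBall_eq (x + (s / 2) • ξ) (by positivity)]
    exact measure_mono ((closedBall_subset_closedCone hξ hcos hcos' hs hsr).trans
      (Set.inter_subset_inter_left _ hsub))
  -- Cones only help for radii up to `r`; a radius `s ≤ R` is first shrunk to `s * (r / R) ≤ r`, at
  -- the cost of the factor `(r / R) ^ d`.
  refine ⟨(r / R * ρ) ^ d * b, R, by positivity, ?_, ?_⟩
  · intro x hx y hy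
    exact (Metric.dist_le_diam_of_mem hΩ_bdd hy hx).trans (le_max_right _ _)
  · intro x hx s hs hsR
    have hrR : r / R ≤ 1 := (div_le_one hR0).2 (le_max_left _ _)
    have h1 : s * (r / R) ≤ r := by
      rw [mul_div_assoc', div_le_iff₀ hR0, mul_comm]
      exact mul_le_mul_of_nonneg_left hsR hr.le
    have h2 : s * (r / R) ≤ s := mul_le_of_le_one_right hs hrR
    refine le_trans (le_of_eq ?_) ((small x hx _ (by positivity) h1).trans
      (measure_mono (Set.inter_subset_inter_right _ (Metric.closedBall_subset_closedBall h2))))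
    congr 1
    rw [mul_assoc s, mul_pow s]
    ring

/-- Exponential bound for the uniform measure of the complement of a ball centred in `Ω`. -/
theorem InteriorConeCondition.exists_cond_compl_closedBall_le {d : ℕ} (hd : d ≠ 0)
    {Ω : Set (EuclideanSpace ℝ (Fin d))} (hΩ_cone : InteriorConeCondition Ω)
    (hΩ_open : IsOpen Ω) (hΩ_ne : Ω.Nonempty) (hΩ_bdd : Bornology.IsBounded Ω) :
    ∃ c : ℝ, 0 < c ∧ ∀ x ∈ Ω, ∀ s, 0 ≤ s →
      ProbabilityTheory.cond volume Ω (Metric.closedBall x s)ᶜ ≤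
        ENNReal.ofReal (Real.exp (-(c * s ^ d))) := by
  obtain ⟨c, R, hc, hR, hvol⟩ := hΩ_cone.exists_volume_inter_closedBall_ge hd hΩ_bdd
  have hfin : volume Ω ≠ ⊤ := hΩ_bdd.measure_lt_top.ne
  have hpos : volume Ω ≠ 0 := (hΩ_open.measure_pos volume hΩ_ne).ne'
  have hv0 : 0 < volume.real Ω := ENNReal.toReal_pos hpos hfin
  have := cond_isProbabilityMeasure_of_finite hpos hfin
  refine ⟨(volume.real Ω)⁻¹ * c, by positivity, fun x hx s hs => ?_⟩
  -- Up to `R` the bound is `1 - u ≤ exp (-u)`; beyond `R` the ball covers `Ω` and the probability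
  -- is zero.
  rcases le_or_gt s R with hsR | hsR
  · rw [prob_compl_eq_one_sub measurableSet_closedBall, cond_apply hΩ_open.measurableSet]
    have h1 : ENNReal.ofReal ((volume.real Ω)⁻¹ * c * s ^ d) ≤
        (volume Ω)⁻¹ * volume (Ω ∩ Metric.closedBall x s) := by
      rw [mul_assoc, ENNReal.ofReal_mul (by positivity), ENNReal.ofReal_inv_of_pos hv0,
        measureReal_def, ENNReal.ofReal_toReal hfin]
      gcongr
      exact hvol x hx s hs hsR
    refine (tsub_le_tsub_left h1 1).trans ?_
    rw [← ENNReal.ofReal_one, ← ENNReal.ofReal_sub _ (by positivity)]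
    refine ENNReal.ofReal_le_ofReal ?_
    have := Real.add_one_le_exp (-((volume.real Ω)⁻¹ * c * s ^ d))
    linarith
  · rw [cond_apply hΩ_open.measurableSet]
    have h0 : Ω ∩ (Metric.closedBall x s)ᶜ = ∅ := by
      rw [← Set.sdiff_eq, Set.sdiff_eq_empty]
      exact (hR x hx).trans (Metric.closedBall_subset_closedBall hsR.le)
    simp [h0]

theorem cond_volume_closedBall_le {d : ℕ} {Ω : Set (EuclideanSpace ℝ (Fin d))}
    (hΩ_open : IsOpen Ω) (x : EuclideanSpace ℝ (Fin d)) {s : ℝ} (hs : 0 ≤ s) :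
    ProbabilityTheory.cond volume Ω (Metric.closedBall x s) ≤
      (volume Ω)⁻¹ * ENNReal.ofReal
        (s ^ d * volume.real (Metric.ball (0 : EuclideanSpace ℝ (Fin d)) 1)) := by
  rw [cond_apply hΩ_open.measurableSet, ← volume_closedBall_eq x hs]
  gcongr
  exact Set.inter_subset_right

/-- The local limit: the probability that a rescaled ball around an interior point is missed by
`n` uniform points. -/
theorem tendsto_cond_compl_closedBall_pow {d : ℕ} (hd : d ≠ 0)
    {Ω : Set (EuclideanSpace ℝ (Fin d))} (hΩ_open : IsOpen Ω)
    (hΩ_bdd : Bornology.IsBounded Ω) {x : EuclideanSpace ℝ (Fin d)} (hx : x ∈ Ω)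
    {t : ℝ} (ht : 0 ≤ t) :
    Tendsto (fun n : ℕ => ProbabilityTheory.cond volume Ω
        (Metric.closedBall x (t / (n : ℝ) ^ (1 / (d : ℝ))))ᶜ ^ n) atTop
      (𝓝 (ENNReal.ofReal (Real.exp (-(volume.real
        (Metric.ball (0 : EuclideanSpace ℝ (Fin d)) 1) / volume.real Ω * t ^ d))))) := by
  set b := volume.real (Metric.ball (0 : EuclideanSpace ℝ (Fin d)) 1) with hb
  have hb0 : 0 < b := volume_real_unitBall_pos d
  have hfin : volume Ω ≠ ⊤ := hΩ_bdd.measure_lt_top.ne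
  have hpos : volume Ω ≠ 0 := (hΩ_open.measure_pos volume ⟨x, hx⟩).ne'
  have hv0 : 0 < volume.real Ω := ENNReal.toReal_pos hpos hfin
  have := cond_isProbabilityMeasure_of_finite hpos hfin
  have hd' : (0 : ℝ) < 1 / (d : ℝ) := by positivity
  have hroot : Tendsto (fun n : ℕ => (n : ℝ) ^ (1 / (d : ℝ))) atTop atTop :=
    (tendsto_rpow_atTop hd').comp tendsto_natCast_atTop_atTop
  have hrad : Tendsto (fun n : ℕ => t / (n : ℝ) ^ (1 / (d : ℝ))) atTop (𝓝 0) :=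
    hroot.const_div_atTop t
  obtain ⟨ε, hε, hball⟩ := Metric.isOpen_iff.1 hΩ_open x hx
  have key := (Real.tendsto_one_add_div_pow_exp (-(b / volume.real Ω * t ^ d)))
  refine ((ENNReal.continuous_ofReal.tendsto _).comp key).congr' ?_
  -- Keeps `1 - u / n` nonnegative, so that `ENNReal.ofReal` commutes with the `n`-th power.
  have hlarge : ∀ᶠ n : ℕ in atTop, b / volume.real Ω * t ^ d ≤ n :=
    tendsto_natCast_atTop_atTop.eventually_ge_atTop _
  filter_upwards [hrad.eventually (gt_mem_nhds hε), eventually_gt_atTop 0, hlarge]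
    with n hn hn0 hnl
  have hn0' : (0 : ℝ) < n := by exact_mod_cast hn0
  have hq : 0 ≤ t / (n : ℝ) ^ (1 / (d : ℝ)) := by positivity
  have hsub : Metric.closedBall x (t / (n : ℝ) ^ (1 / (d : ℝ))) ⊆ Ω :=
    (Metric.closedBall_subset_ball hn).trans hball
  have hpow : ((n : ℝ) ^ (1 / (d : ℝ))) ^ d = n := by
    rw [one_div, Real.rpow_inv_natCast_pow hn0'.le hd]
  have hle : b / volume.real Ω * t ^ d / n ≤ 1 := (div_le_one hn0').2 hnl
  rw [Function.comp_apply, prob_compl_eq_one_sub measurableSet_closedBall,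
    cond_apply hΩ_open.measurableSet, Set.inter_eq_right.2 hsub, volume_closedBall_eq x hq, ← hb,
    ← ENNReal.ofReal_toReal hfin, ← measureReal_def, ← ENNReal.ofReal_inv_of_pos hv0,
    ← ENNReal.ofReal_mul (by positivity), ← ENNReal.ofReal_one,
    ← ENNReal.ofReal_sub _ (by positivity), ← ENNReal.ofReal_pow]
  · congr 2
    rw [div_pow, hpow]
    ring
  · rw [div_pow, hpow]
    rw [sub_nonneg]
    refine le_trans (le_of_eq ?_) hle
    ring

/-! ### The layer-cake measure -/

/-- The measure on `(0, ∞)` whose distribution function is `r ↦ r ^ γ`. -/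
noncomputable def rpowMeasure (γ : ℝ) : Measure ℝ :=
  (volume.restrict (Set.Ioi 0)).map fun t => t ^ (1 / γ)

instance (γ : ℝ) : SFinite (rpowMeasure γ) := by
  unfold rpowMeasure
  infer_instance

theorem measurable_rpow_one_div (γ : ℝ) : Measurable fun t : ℝ => t ^ (1 / γ) := by fun_prop

theorem rpowMeasure_Iio {γ r : ℝ} (hγ : 0 < γ) (hr : 0 ≤ r) :
    rpowMeasure γ (Set.Iio r) = ENNReal.ofReal (r ^ γ) := by
  rw [rpowMeasure, Measure.map_apply (measurable_rpow_one_div γ) measurableSet_Iio,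
    Measure.restrict_apply (measurable_rpow_one_div γ measurableSet_Iio)]
  have : (fun t : ℝ => t ^ (1 / γ)) ⁻¹' Set.Iio r ∩ Set.Ioi 0 = Set.Ioo 0 (r ^ γ) := by
    ext t
    simp only [Set.mem_inter_iff, Set.mem_preimage, Set.mem_Iio, Set.mem_Ioi, Set.mem_Ioo,
      one_div]
    rw [and_comm, and_congr_right_iff]
    intro ht
    rw [Real.rpow_inv_lt_iff_of_pos ht.le hr hγ]
  rw [this, Real.volume_Ioo, sub_zero]

theorem ae_rpowMeasure_pos (γ : ℝ) : ∀ᵐ t ∂rpowMeasure γ, 0 < t := by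
  rw [rpowMeasure, ae_map_iff (measurable_rpow_one_div γ).aemeasurable measurableSet_Ioi]
  filter_upwards [ae_restrict_mem measurableSet_Ioi] with t ht
  exact Real.rpow_pos_of_pos ht _

/-- Unfolding the pushforward leaves `∫ exp (-c * u ^ (d / γ)) du` over `(0, ∞)`, a Gamma integral;
with `c = κ` this is the limit constant. -/
theorem lintegral_rpowMeasure_exp {d : ℕ} (hd : d ≠ 0) {γ c : ℝ} (hγ : 0 < γ) (hc : 0 < c) :
    ∫⁻ t, ENNReal.ofReal (Real.exp (-(c * t ^ d))) ∂rpowMeasure γ =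
      ENNReal.ofReal (c⁻¹ ^ (γ / d) * Real.Gamma (1 + γ / d)) := by
  have hd0 : (0 : ℝ) < d := by positivity
  have hp : 0 < (d : ℝ) / γ := by positivity
  rw [rpowMeasure, lintegral_map (by fun_prop) (measurable_rpow_one_div γ)]
  have h1 : ∀ t ∈ Set.Ioi (0 : ℝ), ENNReal.ofReal (Real.exp (-(c * (t ^ (1 / γ)) ^ d))) =
      ENNReal.ofReal (Real.exp (-c * t ^ (d / γ))) := by
    intro t ht
    rw [← Real.rpow_natCast, ← Real.rpow_mul (le_of_lt ht), neg_mul]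
    congr 5
    ring
  rw [setLIntegral_congr_fun measurableSet_Ioi h1, ← ofReal_integral_eq_lintegral_ofReal]
  · rw [integral_exp_neg_mul_rpow hp hc, Real.inv_rpow hc.le, ← Real.rpow_neg hc.le]
    congr 3
    · field_simp
    · rw [one_div_div, add_comm]
  · simpa [IntegrableOn] using
      integrableOn_rpow_mul_exp_neg_mul_rpow (s := 0) (by norm_num) hp hc
  · exact ae_of_all _ fun t => (Real.exp_pos _).le

/-! ### Scaled distances for a fixed outcome -/

/-- The distance from `x` to the first `n` points, in units of `n ^ (-1 / d)`. -/
noncomputable def scaledDist {S : Type*} {d : ℕ} (X : ℕ → S → EuclideanSpace ℝ (Fin d)) (n : ℕ)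
    (ω : S) (x : EuclideanSpace ℝ (Fin d)) : ℝ :=
  (n : ℝ) ^ (1 / (d : ℝ)) * Metric.infDist x (randomPoints X n ω)

/-- The outcomes and pairs `(x, t)` such that the scaled distance at `x` exceeds `t`. -/
def exceedSet {S : Type*} {d : ℕ} (X : ℕ → S → EuclideanSpace ℝ (Fin d)) (n : ℕ) :
    Set (S × (EuclideanSpace ℝ (Fin d) × ℝ)) :=
  {p | p.2.2 < scaledDist X n p.1 p.2.1}

section Deterministic

variable {S : Type*} {d : ℕ} {X : ℕ → S → EuclideanSpace ℝ (Fin d)} {n : ℕ}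

theorem randomPoints_eq_image (X : ℕ → S → EuclideanSpace ℝ (Fin d)) (n : ℕ) (ω : S) :
    randomPoints X n ω = (fun i => X i ω) '' Set.Iio n := by
  ext y
  simp [randomPoints, eq_comm]

theorem finite_randomPoints (X : ℕ → S → EuclideanSpace ℝ (Fin d)) (n : ℕ) (ω : S) :
    (randomPoints X n ω).Finite := by
  rw [randomPoints_eq_image]
  exact (Set.finite_Iio n).image _

theorem nonempty_randomPoints (hn : 0 < n) (ω : S) : (randomPoints X n ω).Nonempty :=
  ⟨X 0 ω, 0, hn, rfl⟩

/-- The infimum over a finite nonempty set is attained, which keeps the inequality strict.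
Positivity of `n` matters: `Metric.infDist` to the empty set is `0`. -/
theorem lt_infDist_randomPoints_iff (hn : 0 < n) (ω : S) (x : EuclideanSpace ℝ (Fin d)) (t : ℝ) :
    t < Metric.infDist x (randomPoints X n ω) ↔ ∀ i < n, X i ω ∈ (Metric.closedBall x t)ᶜ := by
  simp only [Set.mem_compl_iff, Metric.mem_closedBall, not_le]
  constructor
  · intro h i hi
    rw [dist_comm]
    exact h.trans_le (Metric.infDist_le_dist_of_mem ⟨i, hi, rfl⟩)
  · intro h
    obtain ⟨y, ⟨i, hi, rfl⟩, hy⟩ := (finite_randomPoints X n ω).isCompact.exists_infDist_eq_dist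
      (nonempty_randomPoints hn ω) x
    rw [hy, dist_comm]
    exact h i hi

theorem lt_scaledDist_iff (hn : 0 < n) (ω : S) (x : EuclideanSpace ℝ (Fin d)) (t : ℝ) :
    t < scaledDist X n ω x ↔
      ∀ i < n, X i ω ∈ (Metric.closedBall x (t / (n : ℝ) ^ (1 / (d : ℝ))))ᶜ := by
  have hn' : (0 : ℝ) < n := by exact_mod_cast hn
  rw [← lt_infDist_randomPoints_iff hn, scaledDist, div_lt_iff₀' (by positivity)]

theorem scaledDist_nonneg (ω : S) (x : EuclideanSpace ℝ (Fin d)) : 0 ≤ scaledDist X n ω x :=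
  mul_nonneg (Real.rpow_nonneg n.cast_nonneg _) Metric.infDist_nonneg

theorem scaledDist_rpow (γ : ℝ) (ω : S) (x : EuclideanSpace ℝ (Fin d)) :
    scaledDist X n ω x ^ γ =
      (n : ℝ) ^ (γ / (d : ℝ)) * Metric.infDist x (randomPoints X n ω) ^ γ := by
  rw [scaledDist, Real.mul_rpow (Real.rpow_nonneg n.cast_nonneg _) Metric.infDist_nonneg,
    ← Real.rpow_mul n.cast_nonneg]
  congr 2
  ring

theorem measurable_infDist_randomPoints [MeasurableSpace S] (hX : ∀ i, Measurable (X i)) (n : ℕ) :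
    Measurable fun p : S × EuclideanSpace ℝ (Fin d) =>
      Metric.infDist p.2 (randomPoints X n p.1) := by
  rcases n.eq_zero_or_pos with rfl | hn
  · have : ∀ ω, randomPoints X 0 ω = ∅ := by
      intro ω
      rw [randomPoints_eq_image]
      simp
    simp only [this, Metric.infDist_empty]
    exact measurable_const
  refine measurable_of_Ioi fun t => ?_
  have : (fun p : S × EuclideanSpace ℝ (Fin d) =>
      Metric.infDist p.2 (randomPoints X n p.1)) ⁻¹' Set.Ioi t =
      ⋂ i ∈ Set.Iio n, {p | t < dist (X i p.1) p.2} := by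
    ext p
    simp only [Set.mem_preimage, Set.mem_Ioi, lt_infDist_randomPoints_iff hn]
    simp
  rw [this]
  exact MeasurableSet.biInter (Set.to_countable _) fun i _ =>
    measurableSet_lt measurable_const (((hX i).comp measurable_fst).dist measurable_snd)

theorem measurable_scaledDist [MeasurableSpace S] (hX : ∀ i, Measurable (X i)) (n : ℕ) :
    Measurable fun p : S × EuclideanSpace ℝ (Fin d) => scaledDist X n p.1 p.2 :=
  (measurable_infDist_randomPoints hX n).const_mul _

theorem measurableSet_lt_section {S T : Type*} [MeasurableSpace S] [MeasurableSpace T]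
    {f : S × T → ℝ} (hf : Measurable f) :
    MeasurableSet {p : S × (T × ℝ) | p.2.2 < f (p.1, p.2.1)} :=
  measurableSet_lt (by fun_prop) (by fun_prop)

theorem measurableSet_exceedSet [MeasurableSpace S] (hX : ∀ i, Measurable (X i)) (n : ℕ) :
    MeasurableSet (exceedSet X n) :=
  measurableSet_lt_section (measurable_scaledDist hX n)

/-- Layer-cake formula: the average of the `γ`-th power of the scaled distance is the measure of a
section of `exceedSet`. -/
theorem lintegral_scaledDist_rpow [MeasurableSpace S] (hX : ∀ i, Measurable (X i)) {γ : ℝ}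
    (hγ : 0 < γ) (m : Measure (EuclideanSpace ℝ (Fin d))) (ω : S) :
    ∫⁻ x, ENNReal.ofReal (scaledDist X n ω x ^ γ) ∂m =
      m.prod (rpowMeasure γ) (Prod.mk ω ⁻¹' exceedSet X n) := by
  rw [Measure.prod_apply (measurable_prodMk_left (measurableSet_exceedSet hX n))]
  refine lintegral_congr fun x => ?_
  rw [← rpowMeasure_Iio hγ (scaledDist_nonneg ω x)]
  rfl

end Deterministic

/-! ### Moments of the measure of a random section -/

section Sections

variable {S T : Type*} [MeasurableSpace S] [MeasurableSpace T] {μ : Measure S} {π : Measure T}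
  [SFinite μ] [SFinite π] {A : Set (S × T)}

theorem lintegral_measure_section (hA : MeasurableSet A) :
    ∫⁻ ω, π (Prod.mk ω ⁻¹' A) ∂μ = ∫⁻ z, μ {ω | (ω, z) ∈ A} ∂π := by
  rw [← Measure.prod_apply hA, Measure.prod_apply_symm hA]
  rfl

/-- The square of the measure of a section is the product measure of the section times itself, so
Tonelli applies on pairs. -/
theorem lintegral_measure_section_sq (hA : MeasurableSet A) :
    ∫⁻ ω, π (Prod.mk ω ⁻¹' A) ^ 2 ∂μ =
      ∫⁻ p, μ {ω | (ω, p.1) ∈ A ∧ (ω, p.2) ∈ A} ∂π.prod π := by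
  have hB : MeasurableSet {q : S × (T × T) | (q.1, q.2.1) ∈ A ∧ (q.1, q.2.2) ∈ A} :=
    (measurable_fst.prodMk (measurable_fst.comp measurable_snd) hA).inter
      (measurable_fst.prodMk (measurable_snd.comp measurable_snd) hA)
  have h := lintegral_measure_section (μ := μ) (π := π.prod π) hB
  simp only [Set.mem_ofPred_eq] at h
  rw [← h]
  refine lintegral_congr fun ω => ?_
  rw [sq, ← Measure.prod_prod]
  rfl

end Sections

/-! ### Miss probabilities of one and two balls -/

section Probability

variable {S : Type*} [MeasurableSpace S] {μ : Measure S} {d : ℕ}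
  {X : ℕ → S → EuclideanSpace ℝ (Fin d)} {n : ℕ} {m : Measure (EuclideanSpace ℝ (Fin d))}

theorem measure_forall_lt_mem (hX : ∀ i, Measurable (X i)) (hindep : iIndepFun X μ)
    (hm : ∀ i, μ.map (X i) = m) (n : ℕ) {A : Set (EuclideanSpace ℝ (Fin d))}
    (hA : MeasurableSet A) : μ {ω | ∀ i < n, X i ω ∈ A} = m A ^ n := by
  have h := hindep.measure_inter_preimage_eq_mul (Finset.range n) (sets := fun _ => A)
    (fun _ _ => hA)
  have h1 : {ω | ∀ i < n, X i ω ∈ A} = ⋂ i ∈ Finset.range n, X i ⁻¹' A := by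
    ext ω
    simp
  rw [h1, h]
  have : ∀ i, μ (X i ⁻¹' A) = m A := fun i => by rw [← hm i, Measure.map_apply (hX i) hA]
  simp [this]

/-- The probability that a sample of size `n` misses the ball of radius `t n ^ (-1 / d)`. -/
noncomputable def missProb (m : Measure (EuclideanSpace ℝ (Fin d))) (n : ℕ)
    (z : EuclideanSpace ℝ (Fin d) × ℝ) : ENNReal :=
  m (Metric.closedBall z.1 (z.2 / (n : ℝ) ^ (1 / (d : ℝ))))ᶜ ^ n

theorem measurable_missProb [SFinite m] (n : ℕ) : Measurable (missProb m n) := by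
  have hs : MeasurableSet {p : (EuclideanSpace ℝ (Fin d) × ℝ) × EuclideanSpace ℝ (Fin d) |
      p.1.2 / (n : ℝ) ^ (1 / (d : ℝ)) < dist p.2 p.1.1} :=
    measurableSet_lt (by fun_prop) (by fun_prop)
  have h := (measurable_measure_prodMk_left (ν := m) hs).pow_const n
  convert h using 2 with z
  unfold missProb
  congr 2
  ext y
  simp

theorem measure_section_exceedSet (hX : ∀ i, Measurable (X i)) (hindep : iIndepFun X μ)
    (hm : ∀ i, μ.map (X i) = m) (hn : 0 < n) (z : EuclideanSpace ℝ (Fin d) × ℝ) :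
    μ {ω | (ω, z) ∈ exceedSet X n} = missProb m n z := by
  rw [missProb, ← measure_forall_lt_mem hX hindep hm n measurableSet_closedBall.compl]
  simp only [exceedSet, Set.mem_ofPred_eq, lt_scaledDist_iff hn]

/-- With `a = m A` and `b = m B` this is `1 - a - b ≤ (1 - a) * (1 - b)`. -/
theorem measure_compl_inter_compl_le [IsProbabilityMeasure m]
    {A B : Set (EuclideanSpace ℝ (Fin d))} (hA : MeasurableSet A) (hB : MeasurableSet B)
    (h : Disjoint A B) : m (Aᶜ ∩ Bᶜ) ≤ m Aᶜ * m Bᶜ := by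
  have h1 : m (Aᶜ ∩ Bᶜ) + m A + m B = 1 := by
    rw [← Set.compl_union, add_assoc, ← measure_union h hB, add_comm]
    exact prob_add_prob_compl (hA.union hB)
  rw [prob_compl_eq_one_sub hA, prob_compl_eq_one_sub hB]
  have hAB : m (Aᶜ ∩ Bᶜ) ≠ ⊤ := measure_ne_top _ _
  have hA' : m A ≠ ⊤ := measure_ne_top _ _
  have hB' : m B ≠ ⊤ := measure_ne_top _ _
  lift m (Aᶜ ∩ Bᶜ) to NNReal using hAB with u
  lift m A to NNReal using hA' with a
  lift m B to NNReal using hB' with b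
  norm_cast at h1 ⊢
  have ha : a ≤ 1 := by rw [← h1]; exact le_add_right (le_add_left le_rfl)
  have hb : b ≤ 1 := by rw [← h1]; exact le_add_left le_rfl
  rw [← NNReal.coe_le_coe, NNReal.coe_mul, NNReal.coe_sub ha, NNReal.coe_sub hb]
  have h2 : (u : ℝ) + a + b = 1 := by exact_mod_cast h1
  have := mul_nonneg a.2 b.2
  simp only [NNReal.val_eq_coe] at this
  push_cast
  nlinarith

/-- Two misses are negatively correlated unless the two balls meet. -/
theorem measure_section_exceedSet_inter_le [IsProbabilityMeasure m] (hX : ∀ i, Measurable (X i))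
    (hindep : iIndepFun X μ) (hm : ∀ i, μ.map (X i) = m) (hn : 0 < n)
    (z w : EuclideanSpace ℝ (Fin d) × ℝ)
    (hzw : z.2 / (n : ℝ) ^ (1 / (d : ℝ)) + w.2 / (n : ℝ) ^ (1 / (d : ℝ)) < dist z.1 w.1) :
    μ {ω | (ω, z) ∈ exceedSet X n ∧ (ω, w) ∈ exceedSet X n} ≤
      missProb m n z * missProb m n w := by
  have h1 : {ω | (ω, z) ∈ exceedSet X n ∧ (ω, w) ∈ exceedSet X n} =
      {ω | ∀ i < n, X i ω ∈ (Metric.closedBall z.1 (z.2 / (n : ℝ) ^ (1 / (d : ℝ))))ᶜ ∩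
        (Metric.closedBall w.1 (w.2 / (n : ℝ) ^ (1 / (d : ℝ))))ᶜ} := by
    ext ω
    simp only [exceedSet, Set.mem_ofPred_eq, lt_scaledDist_iff hn, Set.mem_inter_iff]
    exact ⟨fun h i hi => ⟨h.1 i hi, h.2 i hi⟩,
      fun h => ⟨fun i hi => (h i hi).1, fun i hi => (h i hi).2⟩⟩
  rw [h1, measure_forall_lt_mem hX hindep hm n
    (measurableSet_closedBall.compl.inter measurableSet_closedBall.compl), missProb, missProb,
    ← mul_pow]
  exact pow_le_pow_left' (measure_compl_inter_compl_le measurableSet_closedBall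
    measurableSet_closedBall (Metric.closedBall_disjoint_closedBall hzw)) n

end Probability

/-! ### First and second moments -/

section Moments

variable {S : Type*} [MeasurableSpace S] {μ : Measure S} {d : ℕ}
  {X : ℕ → S → EuclideanSpace ℝ (Fin d)} {n : ℕ} {m : Measure (EuclideanSpace ℝ (Fin d))}
  {γ c : ℝ}

/-- The radius scale `n ^ (-1 / d)` puts `1 / n` in the exponent, and the `n`-th power cancels it;
hence a bound uniform in `n`. -/
theorem missProb_le (hd : d ≠ 0) (hn : 0 < n) {z : EuclideanSpace ℝ (Fin d) × ℝ}
    (hz : 0 < z.2)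
    (htail : ∀ s, 0 ≤ s →
      m (Metric.closedBall z.1 s)ᶜ ≤ ENNReal.ofReal (Real.exp (-(c * s ^ d)))) :
    missProb m n z ≤ ENNReal.ofReal (Real.exp (-(c * z.2 ^ d))) := by
  have hn' : (0 : ℝ) < n := by exact_mod_cast hn
  refine (pow_le_pow_left' (htail _ (by positivity)) n).trans (le_of_eq ?_)
  rw [← ENNReal.ofReal_pow (Real.exp_pos _).le, ← Real.exp_nat_mul, div_pow, one_div,
    Real.rpow_inv_natCast_pow hn'.le hd]
  congr 2
  field_simp

theorem ae_prod_rpowMeasure [SFinite m] {P : EuclideanSpace ℝ (Fin d) → Prop}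
    (h : ∀ᵐ x ∂m, P x) : ∀ᵐ z ∂m.prod (rpowMeasure γ), P z.1 ∧ 0 < z.2 :=
  (Measure.quasiMeasurePreserving_fst.ae h).and
    (Measure.quasiMeasurePreserving_snd.ae (ae_rpowMeasure_pos γ))

theorem lintegral_missProb_le [IsProbabilityMeasure m] (hd : d ≠ 0) (hγ : 0 < γ) (hc : 0 < c)
    (hn : 0 < n)
    (htail : ∀ᵐ x ∂m, ∀ s, 0 ≤ s →
      m (Metric.closedBall x s)ᶜ ≤ ENNReal.ofReal (Real.exp (-(c * s ^ d)))) :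
    ∫⁻ z, missProb m n z ∂m.prod (rpowMeasure γ) ≤
      ENNReal.ofReal (c⁻¹ ^ (γ / d) * Real.Gamma (1 + γ / d)) := by
  have h1 : ∫⁻ z, missProb m n z ∂m.prod (rpowMeasure γ) ≤
      ∫⁻ z, ENNReal.ofReal (Real.exp (-(c * z.2 ^ d))) ∂m.prod (rpowMeasure γ) := by
    refine lintegral_mono_ae ?_
    filter_upwards [ae_prod_rpowMeasure (γ := γ) htail] with z hz
    exact missProb_le hd hn hz.2 hz.1
  refine h1.trans (le_of_eq ?_)
  rw [lintegral_prod _ (by fun_prop)]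
  simp [lintegral_rpowMeasure_exp hd hγ hc]

theorem tendsto_lintegral_missProb [IsProbabilityMeasure m] (hd : d ≠ 0) (hγ : 0 < γ)
    (hc : 0 < c)
    (htail : ∀ᵐ x ∂m, ∀ s, 0 ≤ s →
      m (Metric.closedBall x s)ᶜ ≤ ENNReal.ofReal (Real.exp (-(c * s ^ d))))
    {κ : ℝ} (hκ : 0 < κ)
    (hlim : ∀ᵐ x ∂m, ∀ t, 0 ≤ t → Tendsto (fun n : ℕ => missProb m n (x, t)) atTop
      (𝓝 (ENNReal.ofReal (Real.exp (-(κ * t ^ d)))))) :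
    Tendsto (fun n : ℕ => ∫⁻ z, missProb m n z ∂m.prod (rpowMeasure γ)) atTop
      (𝓝 (ENNReal.ofReal (κ⁻¹ ^ (γ / d) * Real.Gamma (1 + γ / d)))) := by
  have hint : ∀ a : ℝ, 0 < a →
      ∫⁻ z, ENNReal.ofReal (Real.exp (-(a * z.2 ^ d))) ∂m.prod (rpowMeasure γ) =
        ENNReal.ofReal (a⁻¹ ^ (γ / d) * Real.Gamma (1 + γ / d)) := by
    intro a ha
    rw [lintegral_prod _ (by fun_prop)]
    simp [lintegral_rpowMeasure_exp hd hγ ha]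
  -- The index is shifted because `missProb m 0` is constantly `1` and escapes the dominating
  -- function.
  rw [← hint κ hκ, ← tendsto_add_atTop_iff_nat 1]
  refine tendsto_lintegral_of_dominated_convergence
    (fun z => ENNReal.ofReal (Real.exp (-(c * z.2 ^ d))))
    (fun n => measurable_missProb _) (fun n => ?_) ?_ ?_
  · filter_upwards [ae_prod_rpowMeasure (γ := γ) htail] with z hz
    exact missProb_le hd n.succ_pos hz.2 hz.1
  · rw [hint c hc]
    exact ENNReal.ofReal_ne_top
  · filter_upwards [ae_prod_rpowMeasure (γ := γ) hlim] with z hz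
    exact (tendsto_add_atTop_iff_nat 1).2 (hz.1 z.2 hz.2.le)

/-- Separates the two radii, so that the overlap integral factorises. -/
theorem add_pow_le_two_pow_mul {s t : ℝ} (hs : 0 ≤ s) (ht : 0 ≤ t) (d : ℕ) :
    (s + t) ^ d ≤ 2 ^ d * ((1 + s ^ d) * (1 + t ^ d)) := by
  have h1 : (2 : ℝ) ^ (d - 1) ≤ 2 ^ d := pow_le_pow_right₀ one_le_two (Nat.sub_le _ _)
  have h2 : s ^ d + t ^ d ≤ (1 + s ^ d) * (1 + t ^ d) := by
    nlinarith [pow_nonneg hs d, pow_nonneg ht d, mul_nonneg (pow_nonneg hs d) (pow_nonneg ht d)]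
  exact (add_pow_le hs ht d).trans (mul_le_mul h1 h2 (by positivity) (by positivity))

/-- Half of the remaining exponential decay absorbs the polynomial factor. -/
theorem one_add_mul_exp_le (hc : 0 < c) {u : ℝ} (hu : 0 ≤ u) :
    (1 + u) * Real.exp (-(c / 2 * u)) ≤ (1 + 4 / c) * Real.exp (-(c / 4 * u)) := by
  have h1 : 1 + u ≤ (1 + 4 / c) * Real.exp (c / 4 * u) := by
    have h2 := Real.add_one_le_exp (c / 4 * u)
    calc 1 + u ≤ (1 + 4 / c) * (c / 4 * u + 1) := by
          have h3 : (1 + 4 / c) * (c / 4 * u + 1) = 1 + u + 4 / c + c / 4 * u := by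
            field_simp
            ring
          rw [h3]
          have : 0 ≤ 4 / c + c / 4 * u := by positivity
          linarith
      _ ≤ _ := by gcongr
  calc (1 + u) * Real.exp (-(c / 2 * u))
      ≤ ((1 + 4 / c) * Real.exp (c / 4 * u)) * Real.exp (-(c / 2 * u)) := by gcongr
    _ = _ := by
      rw [mul_assoc, ← Real.exp_add]
      congr 2
      ring

/-- The contribution of two meeting balls to the second moment. -/
noncomputable def overlapTerm (d n : ℕ) (c : ℝ)
    (p : (EuclideanSpace ℝ (Fin d) × ℝ) × (EuclideanSpace ℝ (Fin d) × ℝ)) : ENNReal :=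
  {q : (EuclideanSpace ℝ (Fin d) × ℝ) × (EuclideanSpace ℝ (Fin d) × ℝ) |
      dist q.2.1 q.1.1 ≤ (q.1.2 + q.2.2) / (n : ℝ) ^ (1 / (d : ℝ))}.indicator
    (fun q => ENNReal.ofReal (Real.exp (-(c / 2 * q.1.2 ^ d))) *
      ENNReal.ofReal (Real.exp (-(c / 2 * q.2.2 ^ d)))) p

theorem measurable_overlapTerm (d n : ℕ) (c : ℝ) : Measurable (overlapTerm d n c) :=
  Measurable.indicator (by fun_prop) (measurableSet_le (by fun_prop) (by fun_prop))

/-- Disjoint balls are handled by negative correlation. For meeting balls, the joint probability is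
at most the smaller of the two single bounds, hence at most their geometric mean; this is where the
exponent `c / 2` comes from. -/
theorem measure_section_inter_le_overlap [IsProbabilityMeasure m] (hd : d ≠ 0)
    (hX : ∀ i, Measurable (X i)) (hindep : iIndepFun X μ) (hm : ∀ i, μ.map (X i) = m)
    (hn : 0 < n) {z w : EuclideanSpace ℝ (Fin d) × ℝ}
    (hz : (∀ s, 0 ≤ s →
      m (Metric.closedBall z.1 s)ᶜ ≤ ENNReal.ofReal (Real.exp (-(c * s ^ d)))) ∧ 0 < z.2)
    (hw : (∀ s, 0 ≤ s →
      m (Metric.closedBall w.1 s)ᶜ ≤ ENNReal.ofReal (Real.exp (-(c * s ^ d)))) ∧ 0 < w.2) :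
    μ {ω | (ω, z) ∈ exceedSet X n ∧ (ω, w) ∈ exceedSet X n} ≤
      missProb m n z * missProb m n w + overlapTerm d n c (z, w) := by
  rcases lt_or_ge ((z.2 + w.2) / (n : ℝ) ^ (1 / (d : ℝ))) (dist w.1 z.1) with h | h
  · refine le_add_right (measure_section_exceedSet_inter_le hX hindep hm hn z w ?_)
    rwa [← add_div, dist_comm]
  · refine le_add_left ?_
    rw [overlapTerm, Set.indicator_of_mem (by exact h)]
    have half : ∀ s : ℝ, ENNReal.ofReal (Real.exp (-(c * s ^ d))) =
        ENNReal.ofReal (Real.exp (-(c / 2 * s ^ d))) *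
          ENNReal.ofReal (Real.exp (-(c / 2 * s ^ d))) := by
      intro s
      rw [← ENNReal.ofReal_mul (Real.exp_pos _).le, ← Real.exp_add]
      congr 2
      ring
    have h1 : μ {ω | (ω, z) ∈ exceedSet X n ∧ (ω, w) ∈ exceedSet X n} ≤
        ENNReal.ofReal (Real.exp (-(c * z.2 ^ d))) :=
      (measure_mono fun ω hω => hω.1).trans
        ((measure_section_exceedSet hX hindep hm hn z).le.trans (missProb_le hd hn hz.2 hz.1))
    have h2 : μ {ω | (ω, z) ∈ exceedSet X n ∧ (ω, w) ∈ exceedSet X n} ≤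
        ENNReal.ofReal (Real.exp (-(c * w.2 ^ d))) :=
      (measure_mono fun ω hω => hω.2).trans
        ((measure_section_exceedSet hX hindep hm hn w).le.trans (missProb_le hd hn hw.2 hw.1))
    rw [half] at h1 h2
    rcases le_total (ENNReal.ofReal (Real.exp (-(c / 2 * z.2 ^ d))))
      (ENNReal.ofReal (Real.exp (-(c / 2 * w.2 ^ d)))) with h3 | h3
    · exact h1.trans (mul_le_mul_right h3 _)
    · exact h2.trans (mul_le_mul_left h3 _)

/-- For fixed `x`, `s`, `t`, the second centre is confined to a ball of measure `O((s + t) ^ d /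
n)`. Integrating that centre first produces the factor `1 / n`; the exponentials make the rest
integrable. -/
theorem lintegral_overlapTerm_le [IsProbabilityMeasure m] (hd : d ≠ 0)
    (hc : 0 < c) (hn : 0 < n) {K : ENNReal}
    (hupper : ∀ x s, 0 ≤ s → m (Metric.closedBall x s) ≤ K * ENNReal.ofReal (s ^ d)) :
    ∫⁻ p, overlapTerm d n c p ∂(m.prod (rpowMeasure γ)).prod (m.prod (rpowMeasure γ)) ≤
      K * 2 ^ d * (∫⁻ t, ENNReal.ofReal ((1 + 4 / c) * Real.exp (-(c / 4 * t ^ d)))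
        ∂rpowMeasure γ) ^ 2 * (n : ENNReal)⁻¹ := by
  have hn' : (0 : ℝ) < n := by exact_mod_cast hn
  set H : ℝ → ENNReal := fun t => ENNReal.ofReal ((1 + 4 / c) * Real.exp (-(c / 4 * t ^ d)))
    with hH
  have hHm : Measurable H := by fun_prop
  have inner : ∀ x : EuclideanSpace ℝ (Fin d), ∀ s t : ℝ, 0 < s → 0 < t →
      ∫⁻ y, overlapTerm d n c ((x, s), (y, t)) ∂m ≤
        K * 2 ^ d * (n : ENNReal)⁻¹ * H s * H t := by
    intro x s t hs ht
    have h1 : ∀ y, overlapTerm d n c ((x, s), (y, t)) =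
        (Metric.closedBall x ((s + t) / (n : ℝ) ^ (1 / (d : ℝ)))).indicator
          (fun _ => ENNReal.ofReal (Real.exp (-(c / 2 * s ^ d))) *
            ENNReal.ofReal (Real.exp (-(c / 2 * t ^ d)))) y := by
      intro y
      rw [overlapTerm]
      rfl
    simp only [h1]
    rw [lintegral_indicator_const measurableSet_closedBall]
    have h2 : m (Metric.closedBall x ((s + t) / (n : ℝ) ^ (1 / (d : ℝ)))) ≤
        K * (2 ^ d * (n : ENNReal)⁻¹ *
          (ENNReal.ofReal (1 + s ^ d) * ENNReal.ofReal (1 + t ^ d))) := by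
      refine (hupper x _ (by positivity)).trans (mul_le_mul_right ?_ K)
      rw [div_pow, one_div, Real.rpow_inv_natCast_pow hn'.le hd]
      have h3 : (2 : ENNReal) ^ d * (n : ENNReal)⁻¹ *
          (ENNReal.ofReal (1 + s ^ d) * ENNReal.ofReal (1 + t ^ d)) =
          ENNReal.ofReal (2 ^ d * ((1 + s ^ d) * (1 + t ^ d)) / n) := by
        rw [div_eq_mul_inv, ENNReal.ofReal_mul (by positivity), ENNReal.ofReal_mul (by positivity),
          ENNReal.ofReal_mul (by positivity), ENNReal.ofReal_inv_of_pos hn',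
          ENNReal.ofReal_natCast, ENNReal.ofReal_pow (by norm_num), ENNReal.ofReal_ofNat]
        ring
      rw [h3]
      refine ENNReal.ofReal_le_ofReal ?_
      gcongr
      exact add_pow_le_two_pow_mul hs.le ht.le d
    have h4 : ∀ u : ℝ, 0 < u → ENNReal.ofReal (1 + u ^ d) *
        ENNReal.ofReal (Real.exp (-(c / 2 * u ^ d))) ≤ H u := by
      intro u hu
      rw [← ENNReal.ofReal_mul (by positivity)]
      exact ENNReal.ofReal_le_ofReal (one_add_mul_exp_le hc (by positivity))
    refine (mul_le_mul_right h2 _).trans ?_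
    calc _ = K * 2 ^ d * (n : ENNReal)⁻¹ *
          (ENNReal.ofReal (1 + s ^ d) * ENNReal.ofReal (Real.exp (-(c / 2 * s ^ d)))) *
          (ENNReal.ofReal (1 + t ^ d) * ENNReal.ofReal (Real.exp (-(c / 2 * t ^ d)))) := by ring
      _ ≤ _ := mul_le_mul' (mul_le_mul_right (h4 s hs) _) (h4 t ht)
  have mid : ∀ z : EuclideanSpace ℝ (Fin d) × ℝ, 0 < z.2 →
      ∫⁻ w, overlapTerm d n c (z, w) ∂m.prod (rpowMeasure γ) ≤
        K * 2 ^ d * (n : ENNReal)⁻¹ * H z.2 * ∫⁻ t, H t ∂rpowMeasure γ := by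
    intro z hz
    have hmeas : Measurable fun w => overlapTerm d n c (z, w) :=
      (measurable_overlapTerm d n c).comp measurable_prodMk_left
    rw [lintegral_prod_symm' _ hmeas, ← lintegral_const_mul _ hHm]
    refine lintegral_mono_ae ?_
    filter_upwards [ae_rpowMeasure_pos γ] with t ht
    exact inner z.1 z.2 t hz ht
  rw [lintegral_prod _ (measurable_overlapTerm d n c).aemeasurable]
  calc ∫⁻ z, ∫⁻ w, overlapTerm d n c (z, w) ∂m.prod (rpowMeasure γ) ∂m.prod (rpowMeasure γ)
      ≤ ∫⁻ z, K * 2 ^ d * (n : ENNReal)⁻¹ * H z.2 * (∫⁻ t, H t ∂rpowMeasure γ)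
          ∂m.prod (rpowMeasure γ) := by
        refine lintegral_mono_ae ?_
        filter_upwards [Measure.quasiMeasurePreserving_snd.ae (ae_rpowMeasure_pos γ)] with z hz
        exact mid z hz
    _ = K * 2 ^ d * (n : ENNReal)⁻¹ * (∫⁻ t, H t ∂rpowMeasure γ) *
          ∫⁻ t, H t ∂rpowMeasure γ := by
        rw [lintegral_prod _ (by fun_prop)]
        simp only [lintegral_const, measure_univ, mul_one]
        rw [lintegral_mul_const _ (by fun_prop), lintegral_const_mul _ hHm]
    _ = _ := by ring

/-- The second moment exceeds the square of the first by at most a multiple of `1 / n`. -/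
theorem exists_lintegral_section_sq_le [IsProbabilityMeasure μ] [IsProbabilityMeasure m]
    (hd : d ≠ 0) (hγ : 0 < γ) (hX : ∀ i, Measurable (X i)) (hindep : iIndepFun X μ)
    (hm : ∀ i, μ.map (X i) = m) (hc : 0 < c)
    (htail : ∀ᵐ x ∂m, ∀ s, 0 ≤ s →
      m (Metric.closedBall x s)ᶜ ≤ ENNReal.ofReal (Real.exp (-(c * s ^ d))))
    {K : ENNReal} (hK : K ≠ ⊤)
    (hupper : ∀ x s, 0 ≤ s → m (Metric.closedBall x s) ≤ K * ENNReal.ofReal (s ^ d)) :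
    ∃ M : ENNReal, M ≠ ⊤ ∧ ∀ n : ℕ, 0 < n →
      ∫⁻ ω, m.prod (rpowMeasure γ) (Prod.mk ω ⁻¹' exceedSet X n) ^ 2 ∂μ ≤
        (∫⁻ z, missProb m n z ∂m.prod (rpowMeasure γ)) ^ 2 + M * (n : ENNReal)⁻¹ := by
  refine ⟨K * 2 ^ d * (∫⁻ t, ENNReal.ofReal ((1 + 4 / c) * Real.exp (-(c / 4 * t ^ d)))
    ∂rpowMeasure γ) ^ 2, ?_, fun n hn => ?_⟩
  rotate_left
  · rw [lintegral_measure_section_sq (measurableSet_exceedSet hX n)]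
    have h1 := ae_prod_rpowMeasure (γ := γ) htail
    have h2 := (Measure.quasiMeasurePreserving_fst (μ := m.prod (rpowMeasure γ))
      (ν := m.prod (rpowMeasure γ))).ae h1
    have h3 := (Measure.quasiMeasurePreserving_snd (μ := m.prod (rpowMeasure γ))
      (ν := m.prod (rpowMeasure γ))).ae h1
    have hmeas := measurable_missProb (m := m) n
    calc _ ≤ ∫⁻ p, (missProb m n p.1 * missProb m n p.2 + overlapTerm d n c p)
          ∂(m.prod (rpowMeasure γ)).prod (m.prod (rpowMeasure γ)) := by
          refine lintegral_mono_ae ?_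
          filter_upwards [h2, h3] with p hp hp'
          exact measure_section_inter_le_overlap hd hX hindep hm hn hp hp'
      _ = (∫⁻ z, missProb m n z ∂m.prod (rpowMeasure γ)) ^ 2 +
          ∫⁻ p, overlapTerm d n c p ∂(m.prod (rpowMeasure γ)).prod (m.prod (rpowMeasure γ)) := by
          rw [lintegral_add_right _ (measurable_overlapTerm d n c),
            lintegral_prod_mul hmeas.aemeasurable hmeas.aemeasurable, sq]
      _ ≤ _ := by
        gcongr
        exact lintegral_overlapTerm_le hd hc hn hupper
  · refine ENNReal.mul_ne_top (ENNReal.mul_ne_top hK (by finiteness)) (ENNReal.pow_ne_top ?_)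
    have h5 : ∀ t : ℝ, ENNReal.ofReal ((1 + 4 / c) * Real.exp (-(c / 4 * t ^ d))) =
        ENNReal.ofReal (1 + 4 / c) * ENNReal.ofReal (Real.exp (-(c / 4 * t ^ d))) :=
      fun t => ENNReal.ofReal_mul (by positivity)
    simp only [h5]
    rw [lintegral_const_mul _ (by fun_prop),
      lintegral_rpowMeasure_exp hd hγ (by positivity)]
    exact ENNReal.mul_ne_top ENNReal.ofReal_ne_top ENNReal.ofReal_ne_top

end Moments

/-! ### Convergence tools -/

section Analysis

/-- Convergence along the squares implies convergence for sequences that, up to a power of the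
index, are decreasing. -/
theorem tendsto_of_tendsto_sq {u : ℕ → ℝ} {a C : ℝ} (ha : 0 < a) (hu : ∀ n, 0 ≤ u n)
    (hmono : ∀ k n : ℕ, 0 < k → k ≤ n → u n ≤ ((n : ℝ) / k) ^ a * u k)
    (hsq : Tendsto (fun k : ℕ => u (k ^ 2)) atTop (𝓝 C)) : Tendsto u atTop (𝓝 C) := by
  have hsqrt : Tendsto Nat.sqrt atTop atTop :=
    tendsto_atTop_mono' _ (Eventually.of_forall fun n => le_rfl)
      (tendsto_atTop_atTop.2 fun b => ⟨b ^ 2, fun n hn => Nat.le_sqrt'.2 hn⟩)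
  -- The ratio of consecutive squares to the power `a`. With `k = Nat.sqrt n`, `n` lies between `k ^
  -- 2` and `(k + 1) ^ 2`, so `u n` is squeezed with errors `r k` and its inverse, both tending to
  -- `1`.
  set r : ℕ → ℝ := fun k => ((((k : ℝ) + 1) / k) ^ 2) ^ a with hr
  have hr1 : Tendsto r atTop (𝓝 1) := by
    have h1 : Tendsto (fun k : ℕ => ((k : ℝ) + 1) / k) atTop (𝓝 1) := by
      have h2 : Tendsto (fun k : ℕ => 1 + 1 / (k : ℝ)) atTop (𝓝 (1 + 0)) :=
        tendsto_const_nhds.add tendsto_one_div_atTop_nhds_zero_nat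
      rw [add_zero] at h2
      refine h2.congr' ?_
      filter_upwards [eventually_gt_atTop 0] with k hk
      have : (k : ℝ) ≠ 0 := by exact_mod_cast hk.ne'
      field_simp
    have h3 := (h1.pow 2).rpow_const (p := a) (Or.inl (by norm_num))
    simpa using h3
  have hup : Tendsto (fun n => r (Nat.sqrt n) * u (Nat.sqrt n ^ 2)) atTop (𝓝 C) := by
    simpa using (hr1.comp hsqrt).mul (hsq.comp hsqrt)
  have hlow : Tendsto (fun n => (r (Nat.sqrt n))⁻¹ * u ((Nat.sqrt n + 1) ^ 2)) atTop (𝓝 C) := by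
    simpa using ((hr1.comp hsqrt).inv₀ one_ne_zero).mul
      (((tendsto_add_atTop_iff_nat 1).2 hsq).comp hsqrt)
  refine tendsto_of_tendsto_of_tendsto_of_le_of_le' hlow hup ?_ ?_
  · filter_upwards [eventually_gt_atTop 0] with n hn
    have hk : 0 < Nat.sqrt n := Nat.sqrt_pos.2 hn
    have hk' : (0 : ℝ) < Nat.sqrt n := by exact_mod_cast hk
    have hrpos : 0 < r (Nat.sqrt n) := by positivity
    rw [inv_mul_le_iff₀ hrpos]
    refine (hmono n _ hn (Nat.lt_succ_sqrt' n).le).trans ?_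
    refine mul_le_mul_of_nonneg_right ?_ (hu n)
    refine Real.rpow_le_rpow (by positivity) ?_ ha.le
    rw [div_pow]
    push_cast
    gcongr
    exact_mod_cast Nat.sqrt_le' n
  · filter_upwards [eventually_gt_atTop 0] with n hn
    have hk : 0 < Nat.sqrt n := Nat.sqrt_pos.2 hn
    have hk' : (0 : ℝ) < Nat.sqrt n := by exact_mod_cast hk
    refine (hmono _ n (pow_pos hk 2) (Nat.sqrt_le' n)).trans ?_
    refine mul_le_mul_of_nonneg_right ?_ (hu _)
    refine Real.rpow_le_rpow (by positivity) ?_ ha.le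
    rw [div_pow]
    push_cast
    gcongr
    exact_mod_cast (Nat.lt_succ_sqrt' n).le

/-- The sum of the squares has finite integral, so it is almost surely finite and its terms tend to
zero. -/
theorem ae_tendsto_zero_of_tsum_lintegral_sq {S : Type*} [MeasurableSpace S]
    {μ : Measure S} {f : ℕ → S → ℝ} (hf : ∀ k, Measurable (f k))
    (h : ∑' k, ∫⁻ ω, ENNReal.ofReal (f k ω ^ 2) ∂μ ≠ ⊤) :
    ∀ᵐ ω ∂μ, Tendsto (fun k => f k ω) atTop (𝓝 0) := by
  have hm : ∀ k, Measurable fun ω => ENNReal.ofReal (f k ω ^ 2) :=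
    fun k => ((hf k).pow_const 2).ennreal_ofReal
  rw [← lintegral_tsum fun k => (hm k).aemeasurable] at h
  filter_upwards [ae_lt_top (Measurable.tsum hm) h] with ω hω
  have h1 := ENNReal.tendsto_atTop_zero_of_tsum_ne_top hω.ne
  have h2 := (ENNReal.tendsto_toReal ENNReal.zero_ne_top).comp h1
  have h3 := (Real.continuous_sqrt.tendsto _).comp h2
  rw [tendsto_zero_iff_abs_tendsto_zero]
  refine (h3.congr fun k => ?_).trans_eq (by simp)
  simp [ENNReal.toReal_ofReal (sq_nonneg (f k ω)), Real.sqrt_sq_eq_abs]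

variable {S : Type*} [MeasurableSpace S] {μ : Measure S} [IsProbabilityMeasure μ]

theorem lintegral_rpow_le_lintegral_rpow {f : S → ENNReal} (hf : Measurable f) {q : ℝ}
    (hq : 1 ≤ q) : (∫⁻ x, f x ∂μ) ^ q ≤ ∫⁻ x, f x ^ q ∂μ := by
  have h := eLpNorm'_le_eLpNorm'_of_exponent_le one_pos hq μ hf.aestronglyMeasurable
  simp only [eLpNorm', enorm_eq_self, ENNReal.rpow_one, div_one] at h
  rwa [one_div, ENNReal.le_rpow_inv_iff (by positivity)] at h

/-- The variance identity, arranged as a sum so that nothing is subtracted in `[0, ∞]` before the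
finite term `2 * e * e` is cancelled. -/
theorem lintegral_sq_sub_le {L : S → ENNReal} (hL : Measurable L) {δ : ENNReal}
    (he : ∫⁻ ω, L ω ∂μ ≠ ⊤) (h2 : ∫⁻ ω, L ω ^ 2 ∂μ ≤ (∫⁻ ω, L ω ∂μ) ^ 2 + δ) :
    ∫⁻ ω, ENNReal.ofReal (((L ω).toReal - (∫⁻ ω, L ω ∂μ).toReal) ^ 2) ∂μ ≤ δ := by
  set e := ∫⁻ ω, L ω ∂μ with he_def
  have hpt : ∀ᵐ ω ∂μ, ENNReal.ofReal (((L ω).toReal - e.toReal) ^ 2) + 2 * e * L ω =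
      L ω ^ 2 + e ^ 2 := by
    filter_upwards [ae_lt_top hL he] with ω hω
    lift L ω to NNReal using hω.ne with l
    lift e to NNReal using he with e'
    have h0 : (0 : ℝ) ≤ ((l : ENNReal).toReal - (e' : ENNReal).toReal) ^ 2 := sq_nonneg _
    rw [ENNReal.ofReal_eq_coe_nnreal h0]
    norm_cast
    ext
    push_cast
    simp only [ENNReal.coe_toReal]
    ring
  have hint := lintegral_congr_ae hpt
  rw [lintegral_add_right _ (hL.const_mul _), lintegral_const_mul _ hL,
    lintegral_add_right _ measurable_const, lintegral_const, measure_univ, mul_one,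
    ← he_def] at hint
  have h3 : ∫⁻ ω, ENNReal.ofReal (((L ω).toReal - e.toReal) ^ 2) ∂μ + 2 * e * e ≤
      δ + 2 * e * e := by
    rw [hint]
    calc _ ≤ e ^ 2 + δ + e ^ 2 := by gcongr
      _ = _ := by ring
  exact (ENNReal.add_le_add_iff_right (by finiteness)).1 h3

/-- Mean-square convergence together with bounded moments gives convergence in every `L^p`. -/
theorem tendsto_eLpNorm_zero_of_bounded_moments {D : ℕ → S → ℝ} (hD : ∀ n, Measurable (D n))
    (h2 : Tendsto (fun n => ∫⁻ ω, ‖D n ω‖ₑ ^ (2 : ℝ) ∂μ) atTop (𝓝 0))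
    (hb : ∀ q : ℝ, 1 ≤ q → ∃ B : ENNReal, B ≠ ⊤ ∧ ∀ᶠ n in atTop, ∫⁻ ω, ‖D n ω‖ₑ ^ q ∂μ ≤ B)
    (p : ℝ) :
    Tendsto (fun n => eLpNorm (D n) (ENNReal.ofReal p) μ) atTop (𝓝 0) := by
  suffices h : ∀ p : ℝ, 2 ≤ p →
      Tendsto (fun n => eLpNorm (D n) (ENNReal.ofReal p) μ) atTop (𝓝 0) by
    refine tendsto_of_tendsto_of_tendsto_of_le_of_le tendsto_const_nhds
      (h (max p 2) (le_max_right _ _)) (fun n => zero_le) fun n => ?_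
    exact eLpNorm_le_eLpNorm_of_exponent_le (ENNReal.ofReal_le_ofReal (le_max_left _ _))
      (hD n).aestronglyMeasurable
  clear p
  intro p hp
  have hp0 : 0 < p := by linarith
  -- The exponent comes from Cauchy–Schwarz applied to `|D| ^ p = |D| * |D| ^ (p - 1)`.
  obtain ⟨B, hB, hbound⟩ := hb (2 * (p - 1)) (by linarith)
  have hnorm : ∀ n, eLpNorm (D n) (ENNReal.ofReal p) μ =
      (∫⁻ ω, ‖D n ω‖ₑ ^ p ∂μ) ^ (1 / p) := by
    intro n
    rw [eLpNorm_eq_lintegral_rpow_enorm_toReal (by simpa using hp0) ENNReal.ofReal_ne_top,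
      ENNReal.toReal_ofReal hp0.le]
  have hhold : ∀ n, ∫⁻ ω, ‖D n ω‖ₑ ^ p ∂μ ≤
      (∫⁻ ω, ‖D n ω‖ₑ ^ (2 : ℝ) ∂μ) ^ (1 / 2 : ℝ) *
        (∫⁻ ω, ‖D n ω‖ₑ ^ (2 * (p - 1)) ∂μ) ^ (1 / 2 : ℝ) := by
    intro n
    have hm : Measurable fun ω => ‖D n ω‖ₑ := (hD n).enorm
    have h := ENNReal.lintegral_mul_le_Lp_mul_Lq μ Real.HolderConjugate.two_two
      hm.aemeasurable (hm.pow_const (p - 1)).aemeasurable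
    simp only [Pi.mul_apply, ← ENNReal.rpow_mul, mul_comm (p - 1) 2] at h
    refine le_trans (le_of_eq (lintegral_congr fun ω => ?_)) h
    conv_rhs => rw [← ENNReal.rpow_one ‖D n ω‖ₑ, ← ENNReal.rpow_mul, one_mul]
    rw [← ENNReal.rpow_add_of_nonneg _ _ zero_le_one (by linarith)]
    congr 1
    ring
  have hlim : Tendsto (fun n => ((∫⁻ ω, ‖D n ω‖ₑ ^ (2 : ℝ) ∂μ) ^ (1 / 2 : ℝ) *
      B ^ (1 / 2 : ℝ)) ^ (1 / p)) atTop (𝓝 0) := by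
    have h3 := ((ENNReal.continuous_rpow_const (y := (1 / 2 : ℝ))).tendsto _).comp h2
    rw [ENNReal.zero_rpow_of_pos (by norm_num)] at h3
    have hBf : B ^ (1 / 2 : ℝ) ≠ ⊤ := ENNReal.rpow_ne_top_of_nonneg (by norm_num) hB
    have h4 := ENNReal.Tendsto.mul_const h3 (Or.inr hBf)
    rw [zero_mul] at h4
    have h5 := ((ENNReal.continuous_rpow_const (y := 1 / p)).tendsto _).comp h4
    rwa [ENNReal.zero_rpow_of_pos (by positivity)] at h5
  refine tendsto_of_tendsto_of_tendsto_of_le_of_le' tendsto_const_nhds hlim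
    (Eventually.of_forall fun n => zero_le) ?_
  filter_upwards [hbound] with n hn
  rw [hnorm]
  refine ENNReal.rpow_le_rpow ((hhold n).trans ?_) (by positivity)
  gcongr

end Analysis

/-! ### The scaled average as a random variable -/

section Average

variable {S : Type*} {d : ℕ} {X : ℕ → S → EuclideanSpace ℝ (Fin d)}

/-- The average of the `γ`-th power of the scaled distance, with values in `[0, ∞]`. -/
noncomputable def scaledAverage (X : ℕ → S → EuclideanSpace ℝ (Fin d))
    (m : Measure (EuclideanSpace ℝ (Fin d))) (γ : ℝ) (n : ℕ) (ω : S) : ENNReal :=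
  ∫⁻ x, ENNReal.ofReal (scaledDist X n ω x ^ γ) ∂m

theorem measurable_scaledDist_section (n : ℕ) (ω : S) :
    Measurable (scaledDist X n ω) := by
  unfold scaledDist
  exact (Metric.continuous_infDist_pt _).measurable.const_mul _

theorem scaledDistAverage_eq_toReal {Ω : Set (EuclideanSpace ℝ (Fin d))} {γ : ℝ} (n : ℕ) (ω : S) :
    scaledDistAverage Ω γ n (randomPoints X n ω) =
      (scaledAverage X (ProbabilityTheory.cond volume Ω) γ n ω).toReal := by
  rw [scaledAverage, ← integral_eq_lintegral_of_nonneg_ae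
    (ae_of_all _ fun x => Real.rpow_nonneg (scaledDist_nonneg ω x) γ)
    ((measurable_scaledDist_section n ω).pow_const γ).aestronglyMeasurable]
  simp only [scaledDist_rpow]
  rw [integral_const_mul, ProbabilityTheory.cond, integral_smul_measure, ENNReal.toReal_inv,
    scaledDistAverage, measureReal_def, smul_eq_mul]

/-- Extra points only decrease distances, so the average grows at most by the ratio of the
normalisations. -/
theorem scaledAverage_le_mul {m : Measure (EuclideanSpace ℝ (Fin d))} {γ : ℝ} (hγ : 0 < γ)
    {k n : ℕ} (hk : 0 < k) (hkn : k ≤ n) (ω : S) :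
    scaledAverage X m γ n ω ≤
      ENNReal.ofReal (((n : ℝ) / k) ^ (γ / d)) * scaledAverage X m γ k ω := by
  have hk' : (0 : ℝ) < k := by exact_mod_cast hk
  rw [scaledAverage, scaledAverage, ← lintegral_const_mul _
    ((measurable_scaledDist_section k ω).pow_const γ).ennreal_ofReal]
  refine lintegral_mono fun x => ?_
  rw [← ENNReal.ofReal_mul (by positivity)]
  refine ENNReal.ofReal_le_ofReal ?_
  rw [scaledDist_rpow, scaledDist_rpow, ← mul_assoc, ← Real.mul_rpow (by positivity) hk'.le,
    div_mul_cancel₀ _ hk'.ne']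
  refine mul_le_mul_of_nonneg_left ?_ (by positivity)
  refine Real.rpow_le_rpow Metric.infDist_nonneg ?_ hγ.le
  refine Metric.infDist_le_infDist_of_subset ?_ (nonempty_randomPoints hk ω)
  rintro y ⟨i, hi, rfl⟩
  exact ⟨i, hi.trans_le hkn, rfl⟩

variable [MeasurableSpace S] {μ : Measure S} {m : Measure (EuclideanSpace ℝ (Fin d))} {γ c : ℝ}

theorem scaledAverage_eq_measure_section (hX : ∀ i, Measurable (X i)) (hγ : 0 < γ) (n : ℕ)
    (ω : S) : scaledAverage X m γ n ω =
      m.prod (rpowMeasure γ) (Prod.mk ω ⁻¹' exceedSet X n) :=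
  lintegral_scaledDist_rpow hX hγ m ω

theorem measurable_scaledAverage [SFinite m] (hX : ∀ i, Measurable (X i)) (hγ : 0 < γ) (n : ℕ) :
    Measurable (scaledAverage X m γ n) := by
  have h := measurable_measure_prodMk_left (ν := m.prod (rpowMeasure γ))
    (measurableSet_exceedSet hX n)
  rwa [← funext (scaledAverage_eq_measure_section hX hγ n)] at h

theorem lintegral_scaledAverage [IsProbabilityMeasure μ] [SFinite m]
    (hX : ∀ i, Measurable (X i)) (hindep : iIndepFun X μ) (hm : ∀ i, μ.map (X i) = m)
    (hγ : 0 < γ) {n : ℕ} (hn : 0 < n) :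
    ∫⁻ ω, scaledAverage X m γ n ω ∂μ = ∫⁻ z, missProb m n z ∂m.prod (rpowMeasure γ) := by
  simp only [scaledAverage_eq_measure_section hX hγ]
  rw [lintegral_measure_section (measurableSet_exceedSet hX n)]
  simp only [measure_section_exceedSet hX hindep hm hn]

/-- All moments of the scaled averages are bounded uniformly in the sample size. -/
theorem lintegral_scaledAverage_rpow_le [IsProbabilityMeasure μ] [IsProbabilityMeasure m]
    (hd : d ≠ 0) (hX : ∀ i, Measurable (X i)) (hindep : iIndepFun X μ)
    (hm : ∀ i, μ.map (X i) = m) (hγ : 0 < γ) (hc : 0 < c)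
    (htail : ∀ᵐ x ∂m, ∀ s, 0 ≤ s →
      m (Metric.closedBall x s)ᶜ ≤ ENNReal.ofReal (Real.exp (-(c * s ^ d))))
    {q : ℝ} (hq : 1 ≤ q) {n : ℕ} (hn : 0 < n) :
    ∫⁻ ω, scaledAverage X m γ n ω ^ q ∂μ ≤
      ENNReal.ofReal (c⁻¹ ^ (γ * q / d) * Real.Gamma (1 + γ * q / d)) := by
  have hγq : 0 < γ * q := by positivity
  -- Jensen in the variable `x` moves the power `q` inside, leaving a first moment with exponent `γ
  -- * q`.
  refine le_trans (lintegral_mono fun ω => ?_)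
    ((lintegral_scaledAverage hX hindep hm hγq hn).le.trans
      (lintegral_missProb_le hd hγq hc hn htail))
  refine (lintegral_rpow_le_lintegral_rpow
    ((measurable_scaledDist_section n ω).pow_const γ).ennreal_ofReal hq).trans (le_of_eq ?_)
  refine lintegral_congr fun x => ?_
  have h0 := scaledDist_nonneg (X := X) (n := n) ω x
  rw [ENNReal.ofReal_rpow_of_nonneg (by positivity) (by linarith), ← Real.rpow_mul h0]

end Average

/-! ### Almost sure and mean-square limits -/

section Limit

variable {S : Type*} [MeasurableSpace S] {μ : Measure S} {d : ℕ}
  {X : ℕ → S → EuclideanSpace ℝ (Fin d)} {m : Measure (EuclideanSpace ℝ (Fin d))}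
  [IsProbabilityMeasure m] {γ : ℝ}

/-- Variance of order `1 / n` and convergence of the means imply almost sure convergence, by
monotonicity in the sample. -/
theorem ae_tendsto_scaledAverage (hd : d ≠ 0) (hX : ∀ i, Measurable (X i)) (hγ : 0 < γ) {C : ℝ}
    (hfin : ∀ n : ℕ, 0 < n → ∫⁻ ω, scaledAverage X m γ n ω ∂μ ≠ ⊤)
    (hmean : Tendsto (fun n : ℕ => (∫⁻ ω, scaledAverage X m γ n ω ∂μ).toReal) atTop (𝓝 C))
    {M : ENNReal} (hM : M ≠ ⊤)
    (hvar : ∀ n : ℕ, 0 < n → ∫⁻ ω, ENNReal.ofReal (((scaledAverage X m γ n ω).toReal -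
      (∫⁻ ω, scaledAverage X m γ n ω ∂μ).toReal) ^ 2) ∂μ ≤ M * (n : ENNReal)⁻¹) :
    ∀ᵐ ω ∂μ, Tendsto (fun n => (scaledAverage X m γ n ω).toReal) atTop (𝓝 C) := by
  have hmeas : ∀ n, Measurable (scaledAverage X m γ n) := measurable_scaledAverage hX hγ
  -- Along `(k + 1) ^ 2` the variances are bounded by a summable series; the shift avoids sample
  -- size `0`.
  have hsum : ∑' k : ℕ, ∫⁻ ω, ENNReal.ofReal (((scaledAverage X m γ ((k + 1) ^ 2) ω).toReal -
      (∫⁻ ω, scaledAverage X m γ ((k + 1) ^ 2) ω ∂μ).toReal) ^ 2) ∂μ ≠ ⊤ := by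
    refine ne_top_of_le_ne_top ?_ (ENNReal.tsum_le_tsum fun k => hvar ((k + 1) ^ 2) (by positivity))
    rw [ENNReal.tsum_mul_left]
    refine ENNReal.mul_ne_top hM ?_
    have h1 : Summable fun k : ℕ => (((k : ℝ) + 1) ^ 2)⁻¹ := by
      have := (summable_nat_add_iff 1).2 (Real.summable_nat_pow_inv.2 one_lt_two)
      simpa using this
    have h2 : ∀ k : ℕ, ((((k + 1) ^ 2 : ℕ) : ENNReal))⁻¹ =
        ENNReal.ofReal ((((k : ℝ) + 1) ^ 2)⁻¹) := by
      intro k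
      rw [ENNReal.ofReal_inv_of_pos (by positivity), ← ENNReal.ofReal_natCast]
      push_cast
      rfl
    simp only [h2]
    exact h1.tsum_ofReal_ne_top
  have hae := ae_tendsto_zero_of_tsum_lintegral_sq
    (fun k => (hmeas ((k + 1) ^ 2)).ennreal_toReal.sub_const _) hsum
  have hlt : ∀ᵐ ω ∂μ, ∀ n : ℕ, 0 < n → scaledAverage X m γ n ω < ⊤ := by
    rw [ae_all_iff]
    intro n
    by_cases hn : 0 < n
    · filter_upwards [ae_lt_top (hmeas n) (hfin n hn)] with ω hω _
      exact hω
    · exact ae_of_all _ fun ω h => absurd h hn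
  filter_upwards [hae, hlt] with ω h1 h2
  refine tendsto_of_tendsto_sq (a := γ / d) (by positivity) (fun n => ENNReal.toReal_nonneg) ?_ ?_
  · intro k n hk hkn
    have h3 := ENNReal.toReal_mono (ENNReal.mul_ne_top ENNReal.ofReal_ne_top (h2 k hk).ne)
      (scaledAverage_le_mul (X := X) (m := m) hγ hk hkn ω)
    rwa [ENNReal.toReal_mul, ENNReal.toReal_ofReal (by positivity)] at h3
  · rw [← tendsto_add_atTop_iff_nat 1]
    have hidx : Tendsto (fun k : ℕ => (k + 1) ^ 2) atTop atTop :=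
      (tendsto_pow_atTop two_ne_zero).comp (tendsto_add_atTop_nat 1)
    have h4 := h1.add (hmean.comp hidx)
    simpa using h4

theorem enorm_toReal_sub_rpow_le (a : ENNReal) (C : ℝ) {q : ℝ} (hq : 1 ≤ q) :
    ‖a.toReal - C‖ₑ ^ q ≤ 2 ^ (q - 1) * (a ^ q + ‖C‖ₑ ^ q) := by
  have h1 : ‖a.toReal‖ₑ ≤ a := by
    rw [Real.enorm_of_nonneg ENNReal.toReal_nonneg]
    exact ENNReal.ofReal_toReal_le
  refine (ENNReal.rpow_le_rpow ?_ (by linarith)).trans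
    (ENNReal.rpow_add_le_mul_rpow_add_rpow a ‖C‖ₑ hq)
  exact enorm_sub_le.trans (by gcongr)

theorem tendsto_lintegral_enorm_sq [IsProbabilityMeasure μ]
    {U : ℕ → S → ℝ} (hU : ∀ n, Measurable (U n)) {e : ℕ → ℝ}
    {C : ℝ} (hmean : Tendsto e atTop (𝓝 C)) {M : ENNReal} (hM : M ≠ ⊤)
    (hvar : ∀ n : ℕ, 0 < n →
      ∫⁻ ω, ENNReal.ofReal ((U n ω - e n) ^ 2) ∂μ ≤ M * (n : ENNReal)⁻¹) :
    Tendsto (fun n => ∫⁻ ω, ‖U n ω - C‖ₑ ^ (2 : ℝ) ∂μ) atTop (𝓝 0) := by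
  have hlim : Tendsto (fun n : ℕ => 2 * (M * (n : ENNReal)⁻¹) +
      2 * ENNReal.ofReal ((e n - C) ^ 2)) atTop (𝓝 0) := by
    have h1 : Tendsto (fun n : ℕ => 2 * (M * (n : ENNReal)⁻¹)) atTop (𝓝 (2 * (M * 0))) :=
      ENNReal.Tendsto.const_mul (ENNReal.Tendsto.const_mul ENNReal.tendsto_inv_nat_nhds_zero
        (Or.inr hM)) (Or.inr (by finiteness))
    have h2 : Tendsto (fun n : ℕ => 2 * ENNReal.ofReal ((e n - C) ^ 2)) atTop
        (𝓝 (2 * ENNReal.ofReal ((C - C) ^ 2))) :=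
      ENNReal.Tendsto.const_mul (ENNReal.tendsto_ofReal ((hmean.sub_const C).pow 2))
        (Or.inr (by finiteness))
    simpa using h1.add h2
  refine tendsto_of_tendsto_of_tendsto_of_le_of_le' tendsto_const_nhds hlim
    (Eventually.of_forall fun n => zero_le) ?_
  filter_upwards [eventually_gt_atTop 0] with n hn
  have hm : Measurable fun ω => ENNReal.ofReal ((U n ω - e n) ^ 2) :=
    (((hU n).sub_const _).pow_const 2).ennreal_ofReal
  calc ∫⁻ ω, ‖U n ω - C‖ₑ ^ (2 : ℝ) ∂μ
      ≤ ∫⁻ ω, (2 * ENNReal.ofReal ((U n ω - e n) ^ 2) +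
          2 * ENNReal.ofReal ((e n - C) ^ 2)) ∂μ := by
        refine lintegral_mono fun ω => ?_
        rw [Real.enorm_eq_ofReal_abs, ENNReal.ofReal_rpow_of_nonneg (abs_nonneg _) (by norm_num),
          Real.rpow_two, sq_abs, ← ENNReal.ofReal_ofNat 2, ← ENNReal.ofReal_mul (by norm_num),
          ← ENNReal.ofReal_mul (by norm_num), ← ENNReal.ofReal_add (by positivity) (by positivity)]
        refine ENNReal.ofReal_le_ofReal ?_
        -- `2 * a ^ 2 + 2 * b ^ 2 - (a + b) ^ 2 = (a - b) ^ 2`, with `a = U n ω - e n` and `b = e n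
        -- - C`.
        nlinarith [sq_nonneg (U n ω - e n - (e n - C))]
    _ = 2 * ∫⁻ ω, ENNReal.ofReal ((U n ω - e n) ^ 2) ∂μ +
          2 * ENNReal.ofReal ((e n - C) ^ 2) := by
        rw [lintegral_add_right _ measurable_const, lintegral_const_mul _ hm, lintegral_const,
          measure_univ, mul_one]
    _ ≤ _ := by
        gcongr
        exact hvar n hn

end Limit

/-! ### The main theorem -/

theorem proposition6 {d : ℕ} (hd : 1 ≤ d) {S : Type*} [MeasurableSpace S]
    (μ : Measure S) [IsProbabilityMeasure μ]
    (Ω : Set (EuclideanSpace ℝ (Fin d))) (hΩ_open : IsOpen Ω) (hΩ_ne : Ω.Nonempty)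
    (hΩ_bdd : Bornology.IsBounded Ω) (hΩ_cone : InteriorConeCondition Ω)
    (X : ℕ → S → EuclideanSpace ℝ (Fin d)) (hX_meas : ∀ i, Measurable (X i))
    (hX_indep : iIndepFun X μ) (hX_unif : ∀ i, pdf.IsUniform (X i) Ω μ volume)
    (γ : ℝ) (hγ : 0 < γ) :
    (∀ᵐ ω ∂μ, Tendsto (fun n : ℕ => scaledDistAverage Ω γ n (randomPoints X n ω)) atTop
      (𝓝 (distLimitConstant Ω γ))) ∧
    ∀ p : ℝ, 0 < p →
      (∀ n : ℕ, MemLp (fun ω => scaledDistAverage Ω γ n (randomPoints X n ω))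
        (ENNReal.ofReal p) μ) ∧
      Tendsto (fun n : ℕ => eLpNorm
        (fun ω => scaledDistAverage Ω γ n (randomPoints X n ω) - distLimitConstant Ω γ)
        (ENNReal.ofReal p) μ) atTop (𝓝 0) := by
  have hd0 : d ≠ 0 := by omega
  have hfin : volume Ω ≠ ⊤ := hΩ_bdd.measure_lt_top.ne
  have hpos : volume Ω ≠ 0 := (hΩ_open.measure_pos volume hΩ_ne).ne'
  have hv0 : 0 < volume.real Ω := ENNReal.toReal_pos hpos hfin
  have hb0 := volume_real_unitBall_pos d
  have hprob := cond_isProbabilityMeasure_of_finite hpos hfin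
  obtain ⟨c, hc, htail⟩ :=
    hΩ_cone.exists_cond_compl_closedBall_le hd0 hΩ_open hΩ_ne hΩ_bdd
  set m := ProbabilityTheory.cond volume Ω with hm_def
  have hm : ∀ i, μ.map (X i) = m := hX_unif
  have hmem : ∀ᵐ x ∂m, x ∈ Ω := ae_cond_mem hΩ_open.measurableSet
  have htail' := hmem.mono htail
  set κ := volume.real (Metric.ball (0 : EuclideanSpace ℝ (Fin d)) 1) / volume.real Ω with hκ
  have hκ0 : 0 < κ := by positivity
  have hlim : ∀ᵐ x ∂m, ∀ t, 0 ≤ t → Tendsto (fun n : ℕ => missProb m n (x, t)) atTop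
      (𝓝 (ENNReal.ofReal (Real.exp (-(κ * t ^ d))))) :=
    hmem.mono fun x hx t ht => tendsto_cond_compl_closedBall_pow hd0 hΩ_open hΩ_bdd hx ht
  have hupper : ∀ x s, 0 ≤ s → m (Metric.closedBall x s) ≤ (volume Ω)⁻¹ *
      ENNReal.ofReal (volume.real (Metric.ball (0 : EuclideanSpace ℝ (Fin d)) 1)) *
        ENNReal.ofReal (s ^ d) := by
    intro x s hs
    refine (cond_volume_closedBall_le hΩ_open x hs).trans (le_of_eq ?_)
    rw [ENNReal.ofReal_mul (by positivity)]
    ring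
  have hK : (volume Ω)⁻¹ * ENNReal.ofReal
      (volume.real (Metric.ball (0 : EuclideanSpace ℝ (Fin d)) 1)) ≠ ⊤ :=
    ENNReal.mul_ne_top (ENNReal.inv_ne_top.2 hpos) ENNReal.ofReal_ne_top
  have hC : distLimitConstant Ω γ = κ⁻¹ ^ (γ / d) * Real.Gamma (1 + γ / d) := by
    rw [distLimitConstant, hκ, inv_div]
  have hC0 : 0 ≤ κ⁻¹ ^ (γ / d) * Real.Gamma (1 + γ / d) :=
    mul_nonneg (by positivity) (Real.Gamma_pos_of_pos (by positivity)).le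
  have hmeas : ∀ n, Measurable (scaledAverage X m γ n) := measurable_scaledAverage hX_meas hγ
  have hexp : ∀ n : ℕ, 0 < n → ∫⁻ ω, scaledAverage X m γ n ω ∂μ =
      ∫⁻ z, missProb m n z ∂m.prod (rpowMeasure γ) :=
    fun n hn => lintegral_scaledAverage hX_meas hX_indep hm hγ hn
  have hfinite : ∀ n : ℕ, 0 < n → ∫⁻ ω, scaledAverage X m γ n ω ∂μ ≠ ⊤ := by
    intro n hn
    rw [hexp n hn]
    exact ne_top_of_le_ne_top ENNReal.ofReal_ne_top (lintegral_missProb_le hd0 hγ hc hn htail')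
  have hmean : Tendsto (fun n : ℕ => (∫⁻ ω, scaledAverage X m γ n ω ∂μ).toReal) atTop
      (𝓝 (distLimitConstant Ω γ)) := by
    have h1 := (ENNReal.tendsto_toReal ENNReal.ofReal_ne_top).comp
      (tendsto_lintegral_missProb (γ := γ) hd0 hγ hc htail' hκ0 hlim)
    rw [ENNReal.toReal_ofReal hC0, ← hC] at h1
    refine h1.congr' ?_
    filter_upwards [eventually_gt_atTop 0] with n hn
    rw [hexp n hn, Function.comp_apply]
  obtain ⟨M, hM, hsecond⟩ :=
    exists_lintegral_section_sq_le hd0 hγ hX_meas hX_indep hm hc htail' hK hupper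
  have hvar : ∀ n : ℕ, 0 < n → ∫⁻ ω, ENNReal.ofReal (((scaledAverage X m γ n ω).toReal -
      (∫⁻ ω, scaledAverage X m γ n ω ∂μ).toReal) ^ 2) ∂μ ≤ M * (n : ENNReal)⁻¹ := by
    intro n hn
    refine lintegral_sq_sub_le (hmeas n) (hfinite n hn) ?_
    rw [hexp n hn]
    simp only [scaledAverage_eq_measure_section hX_meas hγ]
    exact hsecond n hn
  have hmoment : ∀ q : ℝ, 1 ≤ q → ∀ n : ℕ, 0 < n → ∫⁻ ω, scaledAverage X m γ n ω ^ q ∂μ ≤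
      ENNReal.ofReal (c⁻¹ ^ (γ * q / d) * Real.Gamma (1 + γ * q / d)) := fun q hq n hn =>
    lintegral_scaledAverage_rpow_le hd0 hX_meas hX_indep hm hγ hc htail' hq hn
  have hcentred : ∀ q : ℝ, 1 ≤ q → ∀ (C : ℝ) (n : ℕ), 0 < n →
      ∫⁻ ω, ‖(scaledAverage X m γ n ω).toReal - C‖ₑ ^ q ∂μ ≤ 2 ^ (q - 1) *
        (ENNReal.ofReal (c⁻¹ ^ (γ * q / d) * Real.Gamma (1 + γ * q / d)) + ‖C‖ₑ ^ q) := by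
    intro q hq C n hn
    refine (lintegral_mono fun ω => enorm_toReal_sub_rpow_le _ C hq).trans ?_
    rw [lintegral_const_mul _ (((hmeas n).pow_const q).add_const _),
      lintegral_add_right _ measurable_const, lintegral_const, measure_univ, mul_one]
    gcongr
    exact hmoment q hq n hn
  have hcentred_fin : ∀ q : ℝ, 1 ≤ q → ∀ C : ℝ, (2 : ENNReal) ^ (q - 1) *
      (ENNReal.ofReal (c⁻¹ ^ (γ * q / d) * Real.Gamma (1 + γ * q / d)) + ‖C‖ₑ ^ q) ≠ ⊤ := by
    intro q hq C
    have h1 : (2 : ENNReal) ^ (q - 1) ≠ ⊤ :=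
      ENNReal.rpow_ne_top_of_nonneg (by linarith) (by finiteness)
    have h2 : ‖C‖ₑ ^ q ≠ ⊤ := ENNReal.rpow_ne_top_of_nonneg (by linarith) (by finiteness)
    exact ENNReal.mul_ne_top h1 (ENNReal.add_ne_top.2 ⟨ENNReal.ofReal_ne_top, h2⟩)
  simp only [scaledDistAverage_eq_toReal, ← hm_def]
  refine ⟨ae_tendsto_scaledAverage hd0 hX_meas hγ hfinite hmean hM hvar, fun p _ => ⟨?_, ?_⟩⟩
  · intro n
    rcases n.eq_zero_or_pos with rfl | hn
    -- Without points the prefactor `0 ^ (γ / d)` vanishes, because the exponent is nonzero.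
    · have h0 : ∀ ω, scaledAverage X m γ 0 ω = 0 := by
        intro ω
        have : γ / d ≠ 0 := by positivity
        simp [scaledAverage, scaledDist_rpow, Real.zero_rpow this]
      simp [h0]
    · have hae : AEStronglyMeasurable (fun ω => (scaledAverage X m γ n ω).toReal) μ :=
        (hmeas n).ennreal_toReal.aestronglyMeasurable
      -- The moment bounds need exponents at least `1`; smaller `p` follow by monotonicity on a
      -- probability space.
      have h1 : (1 : ℝ) ≤ max p 1 := le_max_right _ _
      have h2 : MemLp (fun ω => (scaledAverage X m γ n ω).toReal)
          (ENNReal.ofReal (max p 1)) μ := by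
        refine ⟨hae, ?_⟩
        rw [eLpNorm_lt_top_iff_lintegral_rpow_enorm_lt_top (by simp)
          ENNReal.ofReal_ne_top, ENNReal.toReal_ofReal (by linarith)]
        have h3 := hcentred _ h1 0 n hn
        simp only [sub_zero] at h3
        exact h3.trans_lt (hcentred_fin _ h1 0).lt_top
      exact h2.mono_exponent (ENNReal.ofReal_le_ofReal (le_max_left _ _))
  · refine tendsto_eLpNorm_zero_of_bounded_moments
      (fun n => (hmeas n).ennreal_toReal.sub_const _)
      (tendsto_lintegral_enorm_sq (fun n => (hmeas n).ennreal_toReal) hmean hM hvar) ?_ p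
    intro q hq
    refine ⟨_, hcentred_fin q hq (distLimitConstant Ω γ), ?_⟩
    filter_upwards [eventually_gt_atTop 0] with n hn
    exact hcentred q hq _ n hn
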